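/- Let $\mathcal X,\mathcal Y$ be finite nonempty alphabets and let $W=(W(y|x))$ be a row-stochastic matrix with all entries strictly positive. All logarithms are to base $2$. **Channel and codes.** In the noisy permutation channel of blocklength $n$, an input $x^n\in\mathcal X^n$ produces $Z^n$ with law $\prod_t W(z_t|x_t)$, and the output $Y^n$ is given by $Y_{\sigma(i)}=Z_i$, where $\sigma$ is an independent uniformly random permutation of $\{1,\dots,n\}$. A code with finite nonempty message set $\mathcal M$ is a pair of maps $f:\mathcal M\to\mathcal X^n$, $g:\mathcal Y^n\to\mathcal M\cup\{\mathtt e\}$; its average error probability is $P_e=\mathbb P[g(Y^n)\neq U]$ with $U$ uniform on $\mathcal M$ and $f(U)$ sent. For $\epsilon\in(0,1)$ let $M^\star(n,\epsilon)$ be the largest $|\mathcal M|$ over codes with $P_e\le\epsilon$, and let $C_\epsilon=\liminf_{n\to\infty}\log M^\star(n,\epsilon)/\log n$. **Geometry.** Let $\Delta(\mathcal X)$, $\Delta(\mathcal Y)$ be the probability simplices, $\mathcal P_W=\{pW:p\in\Delta(\mathcal X)\}\subseteq\mathbb R^{\mathcal Y}$, $A=\operatorname{aff}(\mathcal P_W)$,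 $d=\dim\mathcal P_W$ (affine dimension), $\mathcal R_W=A\cap\Delta(\mathcal Y)$. Let $\operatorname{vol}_d$ denote $d$-dimensional Euclidean volume and put $$\lambda_W^\star=\frac{\operatorname{vol}_d(\mathcal P_W)}{\inf_S\operatorname{vol}_d(S)},$$ the infimum being over all $d$-simplices $S$ with $\mathcal R_W\subseteq S\subseteq A$. Fix a minimum-volume simplex $S_W^\star$ among these, with vertices $s_0,\dots,s_d$. Let $T(u)=\sum_i u_is_i$ for $u\in\mathbb R^{d+1}$ with $\sum_i u_i=1$ (an affine bijection onto $A$), let $K_W=T^{-1}(\mathcal P_W)$, let $\Pi_A$ be the orthogonal projection onto $A$, and let $H=T^{-1}\circ\Pi_A$. **Gaussian coefficient.** With $b_y$ and $e_i$ the standard basis vectors of $\mathbb R^{\mathcal Y}$ and $\mathbb R^{d+1}$ and $\Phi$ the standard normal distribution function, let, for $u\in K_W$ and $i\neq j$ in $\{0,\dots,d\}$, $$V_{ij}(u)=\operatorname{Var}_{Y\sim T(u)}\langle H(b_Y)-u,\,e_i-e_j\rangle,$$ $$A_W(c)=\frac1{\operatorname{vol}_d(K_W)}\int_{K_W}\sum_{i\ne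 j}\Phi\Bigl(-\frac1{c\sqrt{V_{ij}(u)}}\Bigr)\,du\quad(c>0),\qquad c_\epsilon=\sup\{c>0:A_W(c)<\epsilon\}.$$ **Statement.** Assume $d\ge1$ and fix $\epsilon\in(0,1)$. 1. For every choice of $S_W^\star$ for which $0<c_\epsilon<\infty$ there is a constant $C$, depending only on $W$, $\epsilon$ and the fixed $S_W^\star$, such that for all sufficiently large $n$ $$\log M^\star(n,\epsilon)\le d\log(c_\epsilon\sqrt n)+\log\lambda_W^\star+C .$$ 2. The $\epsilon$-capacity is $C_\epsilon=d/2$, and $\operatorname{rank}W=d+1$; so $C_\epsilon=(\operatorname{rank}W-1)/2$, whatever $\epsilon\in(0,1)$. -/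

import Mathlib

open MeasureTheory

noncomputable section

namespace NoisyPerm

variable {X Y : Type*} [Fintype X] [Fintype Y]

/-! ### Codes over the noisy permutation channel -/

/-- A code of blocklength `n` with message set `Fin M`.  The decoder output `none` is the
error symbol. -/
structure Code (X Y : Type*) (n M : ℕ) where
  enc : Fin M → Fin n → X
  dec : (Fin n → Y) → Option (Fin M)

/-- Memoryless law of the noisy codeword `z` given the input codeword `x`. -/
def dmcLaw (W : Matrix X Y ℝ) {n : ℕ} (x : Fin n → X) (z : Fin n → Y) : ℝ :=
  ∏ t, W (x t) (z t)

/-- Law of the output of the uniform random permutation block: `y (σ i) = z i` for all `i`, with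
`σ` uniform on the symmetric group. -/
def shuffleLaw [DecidableEq Y] {n : ℕ} (z y : Fin n → Y) : ℝ :=
  (∑ σ : Equiv.Perm (Fin n), if ∀ i, y (σ i) = z i then (1 : ℝ) else 0) / (n.factorial : ℝ)

/-- Law of the output codeword `y` given the input codeword `x`. -/
def permLaw [DecidableEq Y] (W : Matrix X Y ℝ) {n : ℕ} (x : Fin n → X) (y : Fin n → Y) : ℝ :=
  ∑ z : Fin n → Y, dmcLaw W x z * shuffleLaw z y

/-- Average error probability, for a uniformly distributed message. -/
def errProb [DecidableEq Y] (W : Matrix X Y ℝ) {n M : ℕ} (C : Code X Y n M) : ℝ :=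
  (∑ u : Fin M, ∑ y : Fin n → Y, if C.dec y ≠ some u then permLaw W (C.enc u) y else 0) / (M : ℝ)

/-- Maximal number of messages at blocklength `n` and average error probability at most `ε`. -/
def maxMessages [DecidableEq Y] (W : Matrix X Y ℝ) (n : ℕ) (ε : ℝ) : ℕ :=
  sSup {M : ℕ | 0 < M ∧ ∃ C : Code X Y n M, errProb W C ≤ ε}

/-- The `ε`-capacity. -/
def epsCapacity [DecidableEq Y] (W : Matrix X Y ℝ) (ε : ℝ) : EReal :=
  Filter.liminf
    (fun n : ℕ => ((Real.logb 2 (maxMessages W n ε) / Real.logb 2 n : ℝ) : EReal)) Filter.atTop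

/-! ### Reachable output polytope -/

/-- The set of reachable output distributions `p W`. -/
def polytope (W : Matrix X Y ℝ) : Set (EuclideanSpace ℝ Y) :=
  {q | ∃ p ∈ stdSimplex ℝ X, q = WithLp.toLp 2 (Matrix.vecMul p W)}

/-- The affine hull of the reachable output polytope. -/
def hull (W : Matrix X Y ℝ) : AffineSubspace ℝ (EuclideanSpace ℝ Y) :=
  affineSpan ℝ (polytope W)

/-- The affine dimension of the reachable output polytope. -/
def affDim (W : Matrix X Y ℝ) : ℕ :=
  Module.finrank ℝ (hull W).direction

/-- The part of the output probability simplex lying in the affine hull. -/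
def slice (W : Matrix X Y ℝ) : Set (EuclideanSpace ℝ Y) :=
  {q | q ∈ hull W ∧ WithLp.ofLp q ∈ stdSimplex ℝ Y}

/-- The (solid) simplex spanned by the vertices `S.points`. -/
def solid {W : Matrix X Y ℝ} (S : Affine.Simplex ℝ (EuclideanSpace ℝ Y) (affDim W)) :
    Set (EuclideanSpace ℝ Y) :=
  convexHull ℝ (Set.range S.points)

/-- `S` is a `d`-simplex with `slice W ⊆ S ⊆ hull W`. -/
def IsReference (W : Matrix X Y ℝ) (S : Affine.Simplex ℝ (EuclideanSpace ℝ Y) (affDim W)) : Prop :=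
  slice W ⊆ solid S ∧ solid S ⊆ (hull W : Set (EuclideanSpace ℝ Y))

/-- `S` is a minimum-volume `d`-simplex with `slice W ⊆ S ⊆ hull W`. -/
def IsMinReference (W : Matrix X Y ℝ)
    (S : Affine.Simplex ℝ (EuclideanSpace ℝ Y) (affDim W)) : Prop :=
  IsReference W S ∧ ∀ S', IsReference W S' → μHE[affDim W] (solid S) ≤ μHE[affDim W] (solid S')

/-- Volume of the reachable polytope divided by the infimum of the volumes of the reference
simplices. -/
def volRatio (W : Matrix X Y ℝ) : ℝ :=
  (μHE[affDim W] (polytope W) /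
    ⨅ (S : Affine.Simplex ℝ (EuclideanSpace ℝ Y) (affDim W)) (_ : IsReference W S),
      μHE[affDim W] (solid S)).toReal

instance polytope_nonempty [Nonempty X] (W : Matrix X Y ℝ) : Nonempty (polytope W) := by
  classical
  obtain ⟨x⟩ := ‹Nonempty X›
  exact ⟨⟨_, Pi.single x 1, single_mem_stdSimplex ℝ x, rfl⟩⟩

instance hull_nonempty [Nonempty X] (W : Matrix X Y ℝ) : Nonempty (hull W) :=
  inferInstanceAs (Nonempty (affineSpan ℝ (polytope W)))

/-! ### Affine coordinates and the Gaussian coefficient -/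

section Gaussian

variable {W : Matrix X Y ℝ} (S : Affine.Simplex ℝ (EuclideanSpace ℝ Y) (affDim W))

/-- The hyperplane of affine coordinates. -/
def coordPlane (d : ℕ) : Set (EuclideanSpace ℝ (Fin (d + 1))) := {u | ∑ i, u i = 1}

/-- `T u = ∑ i, u i • s i`, where the `s i` are the vertices of `S`. -/
def coordMap (u : EuclideanSpace ℝ (Fin (affDim W + 1))) : EuclideanSpace ℝ Y :=
  ∑ i, u i • S.points i

/-- The preimage of the reachable polytope under `T`. -/
def coordPolytope : Set (EuclideanSpace ℝ (Fin (affDim W + 1))) :=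
  {u | u ∈ coordPlane (affDim W) ∧ coordMap S u ∈ polytope W}

/-- `H q = T⁻¹ (Π q)`, where `Π` is the Euclidean projection onto the affine hull and `T` is
restricted to the hyperplane of affine coordinates. -/
def coordProj [Nonempty X] (q : EuclideanSpace ℝ Y) : EuclideanSpace ℝ (Fin (affDim W + 1)) :=
  Function.invFunOn (coordMap S) (coordPlane (affDim W))
    (EuclideanGeometry.orthogonalProjection (hull W) q : EuclideanSpace ℝ Y)

/-- The transfer fluctuation `⟨H (b y) - u, e i - e j⟩`. -/
def transfer [Nonempty X] [DecidableEq Y] (i j : Fin (affDim W + 1))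
    (u : EuclideanSpace ℝ (Fin (affDim W + 1))) (y : Y) : ℝ :=
  inner ℝ (coordProj S (EuclideanSpace.single y 1) - u)
    (EuclideanSpace.single i 1 - EuclideanSpace.single j 1)

/-- The variance of the transfer fluctuation when `y` has law `T u`. -/
def transferVar [Nonempty X] [DecidableEq Y] (i j : Fin (affDim W + 1))
    (u : EuclideanSpace ℝ (Fin (affDim W + 1))) : ℝ :=
  ∑ y, coordMap S u y * (transfer S i j u y - ∑ y', coordMap S u y' * transfer S i j u y') ^ 2

/-- The average Gaussian union function. -/
def gaussianUnion [Nonempty X] [DecidableEq Y] (c : ℝ) : ℝ :=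
  (μHE[affDim W] (coordPolytope S)).toReal⁻¹ *
    ∫ u in coordPolytope S,
      (∑ ij : Fin (affDim W + 1) × Fin (affDim W + 1) with ij.1 ≠ ij.2,
        ProbabilityTheory.cdf (ProbabilityTheory.gaussianReal 0 1)
          (-(1 / (c * Real.sqrt (transferVar S ij.1 ij.2 u))))) ∂μHE[affDim W]

/-- The average Gaussian coefficient, as an extended nonnegative real. -/
def gaussianCoeff [Nonempty X] [DecidableEq Y] (ε : ℝ) : ENNReal :=
  ⨆ (c : ℝ) (_ : 0 < c ∧ gaussianUnion S c < ε), ENNReal.ofReal c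

end Gaussian

end NoisyPerm

end

/-!
A permutation block erases everything but the symbol counts of the output, so a code is as good as
the number of count vectors it can tell apart.

Converse: Chebyshev confines the counts to a `√n`-neighbourhood of `n • hull W`, which contains
`O(n ^ d * √n ^ (|Y| - 1 - d))` lattice points, while Fourier inversion gives every count vector
mass `O(√n ^ (-(|Y| - 1)))`, since positivity of the entries of `W` bounds the characteristic
function of the counts by `exp (-c * n * ‖θ‖ ^ 2)`. A decoder claims each count vector for one
message in total, so `M * (1 - ε) = O(√n ^ d)` apart from the Chebyshev tail.

Achievability: `W` has `d + 1` linearly independent rows, hence statistics dual to them. When they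
are used with multiplicities from a grid whose spacing is a large multiple of `√n`, the receiver
recovers the grid point by rounding the statistics, again by Chebyshev.

Hence `M⋆ ≍ √n ^ d`, and the constants of the sharper expansion are absorbed by `C`.
-/

namespace NoisyPerm

open Finset MeasureTheory ProbabilityTheory Real

section ProductWeights

variable {ι α : Type*} [Fintype α]

lemma sum_filter_exists_le [Fintype ι] (A : ι → α → Prop) [∀ i, DecidablePred (A i)]
    [DecidablePred fun z => ∃ i, A i z] {f : α → ℝ} (hf : ∀ z, 0 ≤ f z) :
    ∑ z with ∃ i, A i z, f z ≤ ∑ i, ∑ z with A i z, f z := by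
  simp only [sum_filter]
  rw [sum_comm]
  refine sum_le_sum fun z _ => ?_
  have hnonneg : ∀ i ∈ univ, 0 ≤ if A i z then f z else 0 := fun i _ => by
    split_ifs <;> simp [hf z]
  split_ifs with hz
  · obtain ⟨i, hi⟩ := hz
    exact (if_pos hi).ge.trans (single_le_sum hnonneg (mem_univ i))
  · exact sum_nonneg hnonneg

variable [Fintype ι] [DecidableEq ι]

lemma sum_prod_mul_prod {R : Type*} [CommSemiring R] (p f : ι → α → R) :
    ∑ z : ι → α, (∏ t, p t (z t)) * ∏ t, f t (z t) = ∏ t, ∑ y, p t y * f t y := by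
  classical
  simp only [← prod_mul_distrib, Fintype.prod_sum]

lemma chebyshev_prod {p : ι → α → ℝ} (hp : ∀ t y, 0 ≤ p t y) (hsum : ∀ t, ∑ y, p t y = 1)
    (f : ι → α → ℝ) {R : ℝ} (hR : 0 < R) :
    ∑ z : ι → α with R ≤ |∑ t, f t (z t) - ∑ t, ∑ y, p t y * f t y|, ∏ t, p t (z t) ≤
      (∑ t, ∑ y, p t y * f t y ^ 2) / R ^ 2 := by
  classical
  let _ : MeasurableSpace α := ⊤
  let P (t : ι) : PMF α := PMF.ofFintype (fun y => ENNReal.ofReal (p t y)) (by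
    rw [← ENNReal.ofReal_sum_of_nonneg fun y _ => hp t y, hsum, ENNReal.ofReal_one])
  let μ : Measure (ι → α) := Measure.pi fun t => (P t).toMeasure
  have integral_eq (t : ι) (g : α → ℝ) : ∫ y, g y ∂(P t).toMeasure = ∑ y, p t y * g y := by
    simp [PMF.integral_eq_sum, P, hp]
  have hmean : ∫ z, ∑ t, f t (z t) ∂μ = ∑ t, ∑ y, p t y * f t y := by
    rw [integral_finsetSum _ fun _ _ => .of_finite]
    exact sum_congr rfl fun t _ => (integral_comp_eval .of_discrete).trans (integral_eq t _)
  have hvar : Var[fun z => ∑ t, f t (z t); μ] ≤ ∑ t, ∑ y, p t y * f t y ^ 2 := by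
    rw [← Finset.sum_fn, variance_sum_pi fun t => .of_discrete]
    exact sum_le_sum fun t _ => (variance_le_expectation_sq .of_discrete).trans_eq (integral_eq t _)
  have hcheb := meas_ge_le_variance_div_sq (μ := μ) (X := fun z => ∑ t, f t (z t)) .of_discrete hR
  rw [hmean] at hcheb
  calc ∑ z : ι → α with R ≤ |∑ t, f t (z t) - ∑ t, ∑ y, p t y * f t y|, ∏ t, p t (z t)
      = μ.real {z | R ≤ |∑ t, f t (z t) - ∑ t, ∑ y, p t y * f t y|} := by
        rw [← coe_filter_univ, ← sum_measureReal_singleton]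
        refine sum_congr rfl fun z _ => ?_
        simp [μ, P, measureReal_def, ENNReal.toReal_prod, hp]
    _ ≤ Var[fun z => ∑ t, f t (z t); μ] / R ^ 2 :=
        ENNReal.toReal_le_of_le_ofReal (div_nonneg (variance_nonneg _ _) (sq_nonneg R)) hcheb
    _ ≤ _ := by gcongr

end ProductWeights

section SymbolCount

variable {Y : Type*} [DecidableEq Y] {n : ℕ}

/-- The number of occurrences of each symbol in a word, i.e. `n` times its empirical
distribution (its type). -/
def symbolCount (z : Fin n → Y) (a : Y) : ℕ :=
  #{t | z t = a}

lemma symbolCount_comp_perm (z : Fin n → Y) (σ : Equiv.Perm (Fin n)) :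
    symbolCount (z ∘ σ) = symbolCount z := by
  funext a
  exact card_equiv σ (by simp)

lemma exists_perm_of_symbolCount_eq {z z' : Fin n → Y} (h : symbolCount z = symbolCount z') :
    ∃ σ : Equiv.Perm (Fin n), z ∘ σ = z' := by
  have hfiber (a : Y) : Fintype.card {t // z' t = a} = Fintype.card {t // z t = a} := by
    rw [Fintype.card_subtype, Fintype.card_subtype]
    exact (congrFun h a).symm
  exact ⟨Equiv.ofFiberEquiv fun a => Fintype.equivOfCardEq (hfiber a),
    funext (Equiv.ofFiberEquiv_map _)⟩

variable [Fintype Y]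

lemma sum_symbolCount (z : Fin n → Y) : ∑ a, symbolCount z a = n := by
  simpa [symbolCount] using
    (card_eq_sum_card_fiberwise (f := z) (s := univ) (t := univ) fun _ _ => by simp).symm

lemma sum_comp_eq_sum_symbolCount (z : Fin n → Y) (f : Y → ℝ) :
    ∑ t, f (z t) = ∑ a, (symbolCount z a : ℝ) * f a := by
  simp only [symbolCount, ← nsmul_eq_mul, ← sum_const]
  exact (sum_fiberwise' univ z f).symm

lemma exists_word_symbolCount_eq {c : Y → ℕ} (hc : ∑ a, c a = n) :
    ∃ z : Fin n → Y, symbolCount z = c := by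
  obtain ⟨e⟩ : Nonempty (Fin n ≃ Σ a, Fin (c a)) := ⟨Fintype.equivOfCardEq (by simp [hc])⟩
  refine ⟨fun t => (e t).1, funext fun a => ?_⟩
  calc symbolCount (fun t => (e t).1) a = #{s : Σ a, Fin (c a) | s.1 = a} :=
        card_equiv e (by simp)
    _ = c a := by
      rw [← Fintype.card_subtype, Fintype.card_congr (Equiv.sigmaSubtype a), Fintype.card_fin]

variable (n) in
/-- The words of length `n` with prescribed symbol counts, i.e. a type class. -/
def typeClass (c : Y → ℕ) : Finset (Fin n → Y) :=
  {z | symbolCount z = c}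

lemma mem_typeClass {c : Y → ℕ} {z : Fin n → Y} : z ∈ typeClass n c ↔ symbolCount z = c := by
  simp [typeClass]

end SymbolCount

section Channel

variable {X Y : Type*} {W : Matrix X Y ℝ} {n : ℕ}

lemma dmcLaw_nonneg (hW : ∀ x y, 0 ≤ W x y) (x : Fin n → X) (z : Fin n → Y) : 0 ≤ dmcLaw W x z :=
  prod_nonneg fun _ _ => hW _ _

variable [Fintype Y]

lemma sum_dmcLaw (hsum : ∀ x, ∑ y, W x y = 1) (x : Fin n → X) : ∑ z, dmcLaw W x z = 1 := by
  simp [dmcLaw, ← Fintype.prod_sum, hsum]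

lemma chebyshev_dmcLaw (hW : ∀ x y, 0 ≤ W x y) (hsum : ∀ x, ∑ y, W x y = 1) (x : Fin n → X)
    {g : Y → ℝ} {G R : ℝ} (hg : ∀ y, |g y| ≤ G) (hR : 0 < R) :
    ∑ z with R ≤ |∑ t, g (z t) - ∑ t, ∑ y, W (x t) y * g y|, dmcLaw W x z ≤
      n * G ^ 2 / R ^ 2 := by
  have hsecond (t : Fin n) : ∑ y, W (x t) y * g y ^ 2 ≤ G ^ 2 :=
    calc ∑ y, W (x t) y * g y ^ 2 ≤ ∑ y, W (x t) y * G ^ 2 := sum_le_sum fun y _ =>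
          mul_le_mul_of_nonneg_left (sq_le_sq.2 ((hg y).trans (le_abs_self G))) (hW _ _)
      _ = G ^ 2 := by rw [← sum_mul, hsum, one_mul]
  calc _ ≤ (∑ t, ∑ y, W (x t) y * g y ^ 2) / R ^ 2 :=
        chebyshev_prod (fun t => hW (x t)) (fun t => hsum (x t)) (fun _ => g) hR
    _ ≤ (∑ _t : Fin n, G ^ 2) / R ^ 2 := by gcongr with t; exact hsecond t
    _ = n * G ^ 2 / R ^ 2 := by simp

lemma sum_dmcLaw_exists_le_abs_le {ι : Type*} [Fintype ι] (hW : ∀ x y, 0 ≤ W x y)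
    (hsum : ∀ x, ∑ y, W x y = 1) (x : Fin n → X) {g : ι → Y → ℝ} {G R : ℝ}
    (hg : ∀ i y, |g i y| ≤ G) (hR : 0 < R) :
    ∑ z with ∃ i, R ≤ |∑ t, g i (z t) - ∑ t, ∑ y, W (x t) y * g i y|, dmcLaw W x z ≤
      Fintype.card ι * (n * G ^ 2 / R ^ 2) :=
  calc _ ≤ ∑ i, ∑ z with R ≤ |∑ t, g i (z t) - ∑ t, ∑ y, W (x t) y * g i y|, dmcLaw W x z :=
        sum_filter_exists_le _ fun z => dmcLaw_nonneg hW _ _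
    _ ≤ ∑ _i : ι, n * G ^ 2 / R ^ 2 :=
        sum_le_sum fun i _ => chebyshev_dmcLaw hW hsum x (hg i) hR
    _ = Fintype.card ι * (n * G ^ 2 / R ^ 2) := by simp

variable [DecidableEq Y]

lemma permLaw_eq (x : Fin n → X) (y : Fin n → Y) :
    permLaw W x y = (∑ σ : Equiv.Perm (Fin n), dmcLaw W x (y ∘ σ)) / (n.factorial : ℝ) := by
  have hshuffle (σ : Equiv.Perm (Fin n)) (z : Fin n → Y) : (∀ i, y (σ i) = z i) ↔ y ∘ σ = z :=
    funext_iff.symm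
  simp only [permLaw, shuffleLaw, mul_div_assoc', ← sum_div, mul_sum, hshuffle]
  rw [sum_comm]
  simp

lemma permLaw_nonneg (hW : ∀ x y, 0 ≤ W x y) (x : Fin n → X) (y : Fin n → Y) :
    0 ≤ permLaw W x y := by
  rw [permLaw_eq]
  exact div_nonneg (sum_nonneg fun _ _ => dmcLaw_nonneg hW _ _) (Nat.cast_nonneg _)

lemma permLaw_comp_perm (x : Fin n → X) (y : Fin n → Y) (τ : Equiv.Perm (Fin n)) :
    permLaw W x (y ∘ τ) = permLaw W x y := by
  rw [permLaw_eq, permLaw_eq]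
  congr 1
  exact Fintype.sum_equiv (Equiv.mulLeft τ) _ _ fun σ => rfl

lemma sum_permLaw_mul_of_comp_perm (x : Fin n → X) {h : (Fin n → Y) → ℝ}
    (hh : ∀ (y : Fin n → Y) (σ : Equiv.Perm (Fin n)), h (y ∘ σ) = h y) :
    ∑ y, permLaw W x y * h y = ∑ z, dmcLaw W x z * h z := by
  have hshuffle (σ : Equiv.Perm (Fin n)) :
      ∑ y : Fin n → Y, dmcLaw W x (y ∘ σ) * h y = ∑ z, dmcLaw W x z * h z :=
    Fintype.sum_equiv (σ.symm.arrowCongr (Equiv.refl Y)) _ _ fun y => by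
      rw [← hh y σ]
      rfl
  simp only [permLaw_eq, div_mul_eq_mul_div, ← sum_div, sum_mul]
  rw [sum_comm, sum_congr rfl fun σ _ => hshuffle σ, sum_const, card_univ, Fintype.card_perm,
    Fintype.card_fin, nsmul_eq_mul,
    mul_div_cancel_left₀ _ (Nat.cast_ne_zero.2 n.factorial_ne_zero)]

lemma sum_permLaw (hsum : ∀ x, ∑ y, W x y = 1) (x : Fin n → X) : ∑ y, permLaw W x y = 1 := by
  simpa [sum_dmcLaw hsum] using sum_permLaw_mul_of_comp_perm (W := W) x (h := fun _ => 1) (by simp)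

lemma card_typeClass_mul_permLaw (x : Fin n → X) (y : Fin n → Y) :
    #(typeClass n (symbolCount y)) * permLaw W x y =
      ∑ z ∈ typeClass n (symbolCount y), dmcLaw W x z := by
  have hconst : ∀ y' ∈ typeClass n (symbolCount y), permLaw W x y' = permLaw W x y := by
    intro y' hy'
    obtain ⟨σ, rfl⟩ := exists_perm_of_symbolCount_eq (mem_typeClass.1 hy').symm
    exact permLaw_comp_perm x y σ
  have h := sum_permLaw_mul_of_comp_perm (W := W) x
    (h := fun z => if symbolCount z = symbolCount y then 1 else 0)
    fun z σ => by rw [symbolCount_comp_perm]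
  simp only [mul_ite, mul_one, mul_zero, ← sum_filter] at h
  rw [← nsmul_eq_mul, ← sum_const, typeClass, ← h]
  exact (sum_congr rfl hconst).symm

end Channel

section FourierInversion

variable {ι : Type*}

/-- A fundamental domain of `ℝ ^ ι` modulo `(2 * π * ℤ) ^ ι`, over which the characteristic
function of a `ℤ ^ ι`-valued statistic is integrated to recover its law. -/
def phaseBox (ι : Type*) : Set (ι → ℝ) :=
  Set.univ.pi fun _ => Set.Ioc (-π) π

lemma abs_le_pi_of_mem_phaseBox {θ : ι → ℝ} (hθ : θ ∈ phaseBox ι) (a : ι) : |θ a| ≤ π :=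
  abs_le.2 ⟨(hθ a trivial).1.le, (hθ a trivial).2⟩

lemma measurableSet_phaseBox [Countable ι] : MeasurableSet (phaseBox ι) :=
  .univ_pi fun _ => measurableSet_Ioc

variable [Fintype ι]

lemma volume_restrict_phaseBox :
    (volume : Measure (ι → ℝ)).restrict (phaseBox ι) =
      Measure.pi fun _ => volume.restrict (Set.Ioc (-π) π) := by
  rw [phaseBox, volume_pi, Measure.restrict_pi_pi]

lemma setIntegral_phaseBox_prod {𝕜 : Type*} [RCLike 𝕜] (f : ι → ℝ → 𝕜) :
    ∫ θ in phaseBox ι, ∏ a, f a (θ a) = ∏ a, ∫ s in Set.Ioc (-π) π, f a s := by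
  rw [volume_restrict_phaseBox, integral_fintype_prod_eq_prod]

lemma integrableOn_phaseBox {f : (ι → ℝ) → ℂ} (hf : Continuous f) :
    IntegrableOn f (phaseBox ι) :=
  (hf.continuousOn.integrableOn_compact (isCompact_univ_pi fun _ => isCompact_Icc)).mono_set
    (Set.pi_mono fun _ _ => Set.Ioc_subset_Icc_self)

lemma setIntegral_Ioc_cexp_int_mul (m : ℤ) :
    ∫ θ in Set.Ioc (-π) π, Complex.exp (m * θ * Complex.I) = if m = 0 then 2 * (π : ℂ) else 0 := by
  rw [← intervalIntegral.integral_of_le (by linarith [pi_pos])]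
  split_ifs with hm
  · simp [hm, two_mul]
  · have hperiod : Complex.exp (m * Complex.I * (π : ℝ)) =
        Complex.exp (m * Complex.I * ((-π : ℝ) : ℂ)) :=
      Complex.exp_eq_exp_iff_exists_int.2 ⟨m, by push_cast; ring⟩
    simp only [mul_right_comm _ _ Complex.I]
    rw [integral_exp_mul_complex (by simp [hm]), hperiod, sub_self, zero_div]

lemma setIntegral_phaseBox_cexp (m : ι → ℤ) :
    ∫ θ in phaseBox ι, Complex.exp ((∑ a, m a * θ a : ℝ) * Complex.I) =
      if m = 0 then (2 * π : ℂ) ^ Fintype.card ι else 0 := by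
  have hprod (θ : ι → ℝ) : Complex.exp ((∑ a, m a * θ a : ℝ) * Complex.I) =
      ∏ a, Complex.exp (m a * θ a * Complex.I) := by
    rw [← Complex.exp_sum, ← sum_mul]
    push_cast
    rfl
  simp only [hprod]
  rw [setIntegral_phaseBox_prod fun a s => Complex.exp (m a * s * Complex.I)]
  simp only [setIntegral_Ioc_cexp_int_mul, prod_ite_zero, prod_const, card_univ, mem_univ,
    true_imp_iff, funext_iff, Pi.zero_apply]

variable {α : Type*} [Fintype α]

lemma sum_filter_eq_setIntegral_phaseBox (q : α → ℂ) (N : α → ι → ℤ) (m : ι → ℤ) :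
    (∑ z with N z = m, q z) * (2 * π : ℂ) ^ Fintype.card ι =
      ∫ θ in phaseBox ι, (∑ z, q z * Complex.exp ((∑ a, N z a * θ a : ℝ) * Complex.I)) *
        Complex.exp ((-∑ a, m a * θ a : ℝ) * Complex.I) := by
  have hshift (θ : ι → ℝ) (z : α) :
      q z * Complex.exp ((∑ a, N z a * θ a : ℝ) * Complex.I) *
          Complex.exp ((-∑ a, m a * θ a : ℝ) * Complex.I) =
        q z * Complex.exp ((∑ a, (N z - m) a * θ a : ℝ) * Complex.I) := by
    rw [mul_assoc, ← Complex.exp_add, ← add_mul, ← Complex.ofReal_add, ← sub_eq_add_neg,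
      ← sum_sub_distrib]
    simp only [Pi.sub_apply, Int.cast_sub, sub_mul]
  simp only [sum_mul, hshift]
  rw [integral_finsetSum _ fun z _ => integrableOn_phaseBox (by fun_prop), sum_filter]
  refine sum_congr rfl fun z _ => ?_
  rw [integral_const_mul, setIntegral_phaseBox_cexp]
  simp [sub_eq_zero]

lemma norm_sum_filter_le_of_norm_charFun_le {q : α → ℂ} {N : α → ι → ℤ} {b : ℝ} (hb : 0 < b)
    (h : ∀ θ ∈ phaseBox ι, ‖∑ z, q z * Complex.exp ((∑ a, N z a * θ a : ℝ) * Complex.I)‖ ≤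
      exp (-b * ∑ a, θ a ^ 2)) (m : ι → ℤ) :
    ‖∑ z with N z = m, q z‖ ≤ (√(π / b) / (2 * π)) ^ Fintype.card ι := by
  have hprod (θ : ι → ℝ) : exp (-b * ∑ a, θ a ^ 2) = ∏ a, exp (-b * θ a ^ 2) := by
    rw [mul_sum, exp_sum]
  have hint : IntegrableOn (fun θ : ι → ℝ => ∏ a, exp (-b * θ a ^ 2)) (phaseBox ι) := by
    rw [IntegrableOn, volume_restrict_phaseBox]
    exact Integrable.fintype_prod (f := fun _ s => exp (-b * s ^ 2)) fun _ =>
      (integrable_exp_neg_mul_sq hb).restrict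
  rw [div_pow, le_div_iff₀ (by positivity)]
  calc ‖∑ z with N z = m, q z‖ * (2 * π) ^ Fintype.card ι
      = ‖(∑ z with N z = m, q z) * (2 * π : ℂ) ^ Fintype.card ι‖ := by
        simp [abs_of_pos pi_pos]
    _ ≤ ∫ θ in phaseBox ι, ∏ a, exp (-b * θ a ^ 2) := by
        rw [sum_filter_eq_setIntegral_phaseBox]
        refine norm_integral_le_of_norm_le hint ?_
        filter_upwards [ae_restrict_mem measurableSet_phaseBox] with θ hθ
        rw [norm_mul, Complex.norm_exp_ofReal_mul_I, mul_one, ← hprod]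
        exact h θ hθ
    _ = (∫ s in Set.Ioc (-π) π, exp (-b * s ^ 2)) ^ Fintype.card ι := by
        rw [setIntegral_phaseBox_prod fun _ s => exp (-b * s ^ 2), prod_const, card_univ]
    _ ≤ √(π / b) ^ Fintype.card ι := by
        refine pow_le_pow_left₀ (integral_nonneg fun s => (exp_pos _).le) ?_ _
        rw [← integral_gaussian]
        exact setIntegral_le_integral (integrable_exp_neg_mul_sq hb)
          (.of_forall fun s => (exp_pos _).le)

end FourierInversion

section LocalBound

variable {X Y : Type*} [Fintype Y]

lemma norm_sum_mul_cexp_sq (p θ : Y → ℝ) :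
    ‖∑ y, (p y : ℂ) * Complex.exp (θ y * Complex.I)‖ ^ 2 =
      ∑ y, ∑ y', p y * p y' * cos (θ y - θ y') := by
  have hre_im : ∑ y, (p y : ℂ) * Complex.exp (θ y * Complex.I) =
      (∑ y, p y * cos (θ y) : ℝ) + (∑ y, p y * sin (θ y) : ℝ) * Complex.I := by
    push_cast
    rw [sum_mul, ← sum_add_distrib]
    exact sum_congr rfl fun y _ => by rw [Complex.exp_mul_I]; ring
  rw [hre_im, ← Complex.normSq_eq_norm_sq, Complex.normSq_add_mul_I, pow_two, pow_two,
    sum_mul_sum, sum_mul_sum, ← sum_add_distrib]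
  refine sum_congr rfl fun y _ => ?_
  rw [← sum_add_distrib]
  exact sum_congr rfl fun y' _ => by rw [cos_sub]; ring

variable {w : ℝ}

lemma mul_sum_sq_le_sum_mul_one_sub_cos {p : Y → ℝ} (hw : 0 ≤ w) (hp : ∀ y, w ≤ p y)
    {θ : Y → ℝ} {y₀ : Y} (h₀ : θ y₀ = 0) (hθ : ∀ y, |θ y| ≤ π) :
    2 * (w ^ 2 / π ^ 2) * ∑ y, θ y ^ 2 ≤ ∑ y, ∑ y', p y * p y' * (1 - cos (θ y - θ y')) := by
  have hp0 (y : Y) : 0 ≤ p y := hw.trans (hp y)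
  rw [mul_sum]
  refine sum_le_sum fun y _ => ?_
  have hcos : 2 / π ^ 2 * θ y ^ 2 ≤ 1 - cos (θ y) := by
    linarith [cos_le_one_sub_mul_cos_sq (hθ y)]
  calc 2 * (w ^ 2 / π ^ 2) * θ y ^ 2 = w * w * (2 / π ^ 2 * θ y ^ 2) := by ring
    _ ≤ p y * p y₀ * (1 - cos (θ y - θ y₀)) := by
      rw [h₀, sub_zero]
      exact mul_le_mul (mul_le_mul (hp y) (hp y₀) hw (hp0 y)) hcos (by positivity)
        (mul_nonneg (hp0 y) (hp0 y₀))
    _ ≤ ∑ y', p y * p y' * (1 - cos (θ y - θ y')) :=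
      single_le_sum (f := fun y' => p y * p y' * (1 - cos (θ y - θ y')))
        (fun y' _ => mul_nonneg (mul_nonneg (hp0 y) (hp0 y')) (sub_nonneg.2 (cos_le_one _)))
        (mem_univ y₀)

lemma norm_sum_mul_cexp_le {p : Y → ℝ} (hw : 0 ≤ w) (hp : ∀ y, w ≤ p y) (hsum : ∑ y, p y = 1)
    {θ : Y → ℝ} {y₀ : Y} (h₀ : θ y₀ = 0) (hθ : ∀ y, |θ y| ≤ π) :
    ‖∑ y, (p y : ℂ) * Complex.exp (θ y * Complex.I)‖ ≤ exp (-(w ^ 2 / π ^ 2) * ∑ y, θ y ^ 2) := by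
  have htotal : ∑ y, ∑ y', p y * p y' = 1 := by rw [← sum_mul_sum, hsum, one_mul]
  refine le_of_pow_le_pow_left₀ two_ne_zero (exp_nonneg _) ?_
  calc ‖∑ y, (p y : ℂ) * Complex.exp (θ y * Complex.I)‖ ^ 2
      = 1 - ∑ y, ∑ y', p y * p y' * (1 - cos (θ y - θ y')) := by
        simp only [norm_sum_mul_cexp_sq, mul_sub, mul_one, sum_sub_distrib, htotal]
        ring
    _ ≤ -(2 * (w ^ 2 / π ^ 2) * ∑ y, θ y ^ 2) + 1 := by
        linarith [mul_sum_sq_le_sum_mul_one_sub_cos hw hp h₀ hθ]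
    _ ≤ exp (-(2 * (w ^ 2 / π ^ 2) * ∑ y, θ y ^ 2)) := add_one_le_exp _
    _ = exp (-(w ^ 2 / π ^ 2) * ∑ y, θ y ^ 2) ^ 2 := by
        rw [← exp_nat_mul]
        push_cast
        ring_nf

variable [DecidableEq Y] {W : Matrix X Y ℝ} {n : ℕ}

lemma sum_dmcLaw_mul_cexp (x : Fin n → X) (θ : Y → ℝ) :
    ∑ z, (dmcLaw W x z : ℂ) * Complex.exp ((∑ a, symbolCount z a * θ a : ℝ) * Complex.I) =
      ∏ t, ∑ y, (W (x t) y : ℂ) * Complex.exp (θ y * Complex.I) := by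
  rw [← sum_prod_mul_prod (fun t y => (W (x t) y : ℂ)) fun _ y => Complex.exp (θ y * Complex.I)]
  refine sum_congr rfl fun z _ => ?_
  rw [← sum_comp_eq_sum_symbolCount, ← Complex.exp_sum, ← sum_mul, dmcLaw]
  push_cast
  rfl

lemma norm_sum_dmcLaw_mul_cexp_le (hw : 0 ≤ w) (hW : ∀ x y, w ≤ W x y)
    (hsum : ∀ x, ∑ y, W x y = 1) (x : Fin n → X) {θ : Y → ℝ} {y₀ : Y} (h₀ : θ y₀ = 0)
    (hθ : ∀ y, |θ y| ≤ π) :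
    ‖∑ z, (dmcLaw W x z : ℂ) * Complex.exp ((∑ a, symbolCount z a * θ a : ℝ) * Complex.I)‖ ≤
      exp (-(w ^ 2 / π ^ 2 * n) * ∑ y, θ y ^ 2) := by
  rw [sum_dmcLaw_mul_cexp, norm_prod]
  calc ∏ t, ‖∑ y, (W (x t) y : ℂ) * Complex.exp (θ y * Complex.I)‖
      ≤ ∏ _t : Fin n, exp (-(w ^ 2 / π ^ 2) * ∑ y, θ y ^ 2) :=
        prod_le_prod (fun _ _ => norm_nonneg _) fun t _ =>
          norm_sum_mul_cexp_le hw (hW (x t)) (hsum (x t)) h₀ hθ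
    _ = exp (-(w ^ 2 / π ^ 2 * n) * ∑ y, θ y ^ 2) := by
        rw [prod_const, card_univ, Fintype.card_fin, ← exp_nat_mul]
        ring_nf

-- The symbol counts sum to `n`, so the phase of one symbol can be normalised to zero.
lemma norm_sum_dmcLaw_mul_cexp_le_of_mem_phaseBox (hw : 0 ≤ w) (hW : ∀ x y, w ≤ W x y)
    (hsum : ∀ x, ∑ y, W x y = 1) (x : Fin n → X) {y₀ : Y} {θ : {y // y ≠ y₀} → ℝ}
    (hθ : θ ∈ phaseBox {y // y ≠ y₀}) :
    ‖∑ z : Fin n → Y, (dmcLaw W x z : ℂ) *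
        Complex.exp ((∑ a : {y // y ≠ y₀}, symbolCount z a * θ a : ℝ) * Complex.I)‖ ≤
      exp (-(w ^ 2 / π ^ 2 * n) * ∑ a, θ a ^ 2) := by
  set θ' : Y → ℝ := Function.extend (↑) θ 0
  have hθ'_coe (a : {y // y ≠ y₀}) : θ' a = θ a := Subtype.val_injective.extend_apply θ 0 a
  have hθ'_y₀ : θ' y₀ = 0 := Function.extend_apply' _ _ _ fun ⟨a, ha⟩ => a.2 ha
  have hθ'_le (y : Y) : |θ' y| ≤ π := by
    by_cases hy : y = y₀
    · simpa [hy, hθ'_y₀] using pi_pos.le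
    · exact hθ'_coe ⟨y, hy⟩ ▸ abs_le_pi_of_mem_phaseBox hθ _
  have h := norm_sum_dmcLaw_mul_cexp_le hw hW hsum x hθ'_y₀ hθ'_le
  simp only [Fintype.sum_eq_add_sum_subtype_ne _ y₀, hθ'_y₀, hθ'_coe] at h
  simpa using h

lemma sum_typeClass_dmcLaw_le [Nonempty Y] (hw : 0 < w) (hW : ∀ x y, w ≤ W x y)
    (hsum : ∀ x, ∑ y, W x y = 1) (hn : 0 < n) (x : Fin n → X) (τ : Y → ℕ) :
    ∑ z ∈ typeClass n τ, dmcLaw W x z ≤ (√π / (2 * w * √n)) ^ (Fintype.card Y - 1) := by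
  obtain ⟨y₀⟩ := ‹Nonempty Y›
  set reduced : (Y → ℕ) → {y // y ≠ y₀} → ℤ := fun c a => c a
  have : (0 : ℝ) < n := Nat.cast_pos.2 hn
  have hscale : √(π / (w ^ 2 / π ^ 2 * n)) / (2 * π) = √π / (2 * w * √n) := by
    rw [sqrt_div pi_pos.le, sqrt_mul (by positivity), sqrt_div (by positivity), sqrt_sq hw.le,
      sqrt_sq pi_pos.le]
    field_simp
  calc ∑ z ∈ typeClass n τ, dmcLaw W x z
      ≤ ∑ z with reduced (symbolCount z) = reduced τ, dmcLaw W x z :=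
        sum_le_sum_of_subset_of_nonneg (fun z hz => by simp [mem_typeClass.1 hz])
          fun z _ _ => dmcLaw_nonneg (fun x y => hw.le.trans (hW x y)) x z
    _ ≤ ‖∑ z with reduced (symbolCount z) = reduced τ, (dmcLaw W x z : ℂ)‖ := by
        rw [← Complex.ofReal_sum, Complex.norm_real]
        exact le_abs_self _
    _ ≤ (√(π / (w ^ 2 / π ^ 2 * n)) / (2 * π)) ^ Fintype.card {y // y ≠ y₀} :=
        norm_sum_filter_le_of_norm_charFun_le (by positivity) (fun θ hθ => by
          simpa [reduced] using
            norm_sum_dmcLaw_mul_cexp_le_of_mem_phaseBox hw.le hW hsum x hθ) _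
    _ = (√π / (2 * w * √n)) ^ (Fintype.card Y - 1) := by
        rw [hscale, Fintype.card_subtype_compl, Fintype.card_subtype_eq]

end LocalBound

section LinearAlgebra

variable {K V : Type*}

section Module

variable [DivisionRing K] [AddCommGroup V] [Module K V]

lemma span_eq_vectorSpan_sup_span_singleton {s : Set V} {p : V} (hp : p ∈ s) :
    Submodule.span K s = vectorSpan K s ⊔ Submodule.span K {p} := by
  refine le_antisymm (Submodule.span_le.2 fun v hv => ?_) (sup_le ?_ ?_)
  · simpa using Submodule.add_mem_sup (vsub_mem_vectorSpan K hv hp)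
      (Submodule.mem_span_singleton_self (R := K) p)
  · rw [vectorSpan_def, Submodule.span_le]
    rintro _ ⟨a, ha, b, hb, rfl⟩
    exact Submodule.sub_mem _ (Submodule.subset_span ha) (Submodule.subset_span hb)
  · exact Submodule.span_mono (Set.singleton_subset_iff.2 hp)

lemma finrank_span_eq_finrank_vectorSpan_add_one [FiniteDimensional K V] {s : Set V}
    (hs : s.Nonempty) (f : V →ₗ[K] K) (hf : ∀ v ∈ s, f v = 1) :
    Module.finrank K (Submodule.span K s) = Module.finrank K (vectorSpan K s) + 1 := by
  obtain ⟨p, hp⟩ := hs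
  have hp0 : p ≠ 0 := by
    rintro rfl
    simpa using hf 0 hp
  have hker : vectorSpan K s ≤ LinearMap.ker f := by
    rw [vectorSpan_def, Submodule.span_le]
    rintro _ ⟨a, ha, b, hb, rfl⟩
    simp [hf a ha, hf b hb]
  have hinf : vectorSpan K s ⊓ Submodule.span K {p} = ⊥ := by
    rw [eq_bot_iff]
    rintro _ ⟨hv, hvp⟩
    obtain ⟨c, rfl⟩ := Submodule.mem_span_singleton.1 hvp
    have hc : c = 0 := by simpa [hf p hp] using hker hv
    simp [hc]
  have h := Submodule.finrank_sup_add_finrank_inf_eq (vectorSpan K s) (Submodule.span K {p})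
  rwa [hinf, finrank_bot, add_zero, finrank_span_singleton hp0,
    ← span_eq_vectorSpan_sup_span_singleton hp] at h

lemma exists_finset_eq_smul_add_sum {ι : Type*} [Finite ι] (v : ι → V) {u : V} (hu : u ≠ 0)
    (hmem : u ∈ Submodule.span K (Set.range v)) :
    ∃ I : Finset ι, #I + 1 = Module.finrank K (Submodule.span K (Set.range v)) ∧
      ∀ j, ∃ (a : K) (L : I → K), v j = a • u + ∑ i, L i • v i := by
  classical
  have := Fintype.ofFinite ι
  let v' : Option ι → V := fun o => o.elim u v
  have hnone : LinearIndepOn K v' {none} := (linearIndepOn_singleton_iff K).2 hu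
  obtain ⟨b, -, hb_none, hb_span, hb_indep⟩ :=
    exists_linearIndepOn_extension hnone (Set.subset_univ _)
  set I : Finset ι := {i | some i ∈ b}
  have hb : b = insert none (some '' (I : Set ι)) := by
    ext (_ | i)
    · simpa using hb_none
    · simp [I]
  have hspan : Submodule.span K (v' '' b) = Submodule.span K (Set.range v) := by
    refine le_antisymm (Submodule.span_le.2 ?_) (Submodule.span_le.2 ?_)
    · rintro _ ⟨_ | i, -, rfl⟩
      exacts [hmem, Submodule.subset_span ⟨i, rfl⟩]
    · rintro _ ⟨i, rfl⟩
      exact hb_span ⟨some i, trivial, rfl⟩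
  refine ⟨I, ?_, fun j => ?_⟩
  · rw [← hspan, Set.image_eq_range, finrank_span_eq_card hb_indep.linearIndependent,
      ← Set.toFinset_card, ← card_insertNone]
    congr 1
    ext (_ | i)
    · simpa using hb_none
    · simp [I]
  · have hj : v j ∈ Submodule.span K (insert u (v '' I)) := by
      rw [show insert u (v '' I) = v' '' b by simp [hb, Set.image_insert_eq, Set.image_image, v'],
        hspan]
      exact Submodule.subset_span ⟨j, rfl⟩
    obtain ⟨a, z, hz, hvj⟩ := Submodule.mem_span_insert.1 hj
    obtain ⟨L, rfl⟩ := (Submodule.mem_span_image_finset_iff_exists_fun K).1 hz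
    exact ⟨a, L, hvj⟩

end Module

lemma exists_submatrix_mul_eq_one {m n : Type*} [Finite m] [Fintype n] [Field K]
    {A : Matrix m n K} {k : ℕ} (hA : A.rank = k) :
    ∃ (r : Fin k → m) (B : Matrix n (Fin k) K), A.submatrix r id * B = 1 := by
  obtain rfl := A.rank_eq_finrank_span_row.symm.trans hA
  obtain ⟨f, hf_mem, -, hf_indep⟩ :=
    Submodule.exists_fun_fin_finrank_span_eq K (Set.range A.row)
  choose r hr using hf_mem
  have hrows : LinearIndependent K (A.submatrix r id).row := by
    rwa [show (A.submatrix r id).row = f from funext hr]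
  have hsurj : LinearMap.range (A.submatrix r id).mulVecLin = ⊤ :=
    Submodule.eq_top_of_finrank_eq
      (hrows.rank_matrix.trans (Module.finrank_fintype_fun_eq_card K).symm)
  exact ⟨r, Matrix.mulVec_surjective_iff_exists_right_inverse.1 (LinearMap.range_eq_top.1 hsurj)⟩

variable {X Y : Type*} [Fintype X]

lemma span_polytope (W : Matrix X Y ℝ) :
    Submodule.span ℝ (polytope W) =
      (Submodule.span ℝ (Set.range W.row)).map
        (WithLp.linearEquiv 2 ℝ (Y → ℝ)).symm.toLinearMap := by
  classical
  refine le_antisymm (Submodule.span_le.2 ?_) ?_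
  · rintro _ ⟨p, -, rfl⟩
    refine ⟨Matrix.vecMul p W, ?_, rfl⟩
    rw [Matrix.vecMul_eq_sum]
    exact Submodule.sum_mem _ fun x _ =>
      Submodule.smul_mem _ _ (Submodule.subset_span ⟨x, rfl⟩)
  · rw [Submodule.map_span, Submodule.span_le]
    rintro _ ⟨_, ⟨x, rfl⟩, rfl⟩
    refine Submodule.subset_span ⟨Pi.single x 1, single_mem_stdSimplex ℝ x, ?_⟩
    rw [Matrix.single_one_vecMul]
    rfl

variable [Fintype Y] [Nonempty X] {W : Matrix X Y ℝ}

lemma rank_eq_affDim_add_one (hsum : ∀ x, ∑ y, W x y = 1) : W.rank = affDim W + 1 := by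
  have htotal : ∀ q ∈ polytope W, ((∑ y, LinearMap.proj y : (Y → ℝ) →ₗ[ℝ] ℝ) ∘ₗ
      (WithLp.linearEquiv 2 ℝ (Y → ℝ)).toLinearMap) q = 1 := by
    rintro _ ⟨p, hp, rfl⟩
    simp only [LinearMap.comp_apply, LinearMap.sum_apply, LinearMap.proj_apply]
    change ∑ y, ∑ x, p x * W x y = 1
    rw [sum_comm]
    simp only [← mul_sum, hsum, mul_one, hp.2]
  have h := finrank_span_eq_finrank_vectorSpan_add_one (Set.nonempty_coe_sort.1 inferInstance)
    _ htotal
  rw [span_polytope, LinearEquiv.finrank_map_eq, ← Matrix.rank_eq_finrank_span_row] at h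
  rw [h, affDim, hull, direction_affineSpan]

lemma affDim_lt_card (hsum : ∀ x, ∑ y, W x y = 1) : affDim W < Fintype.card Y :=
  (rank_eq_affDim_add_one hsum).symm.trans_le W.rank_le_card_width

lemma exists_affine_column_basis (hsum : ∀ x, ∑ y, W x y = 1) :
    ∃ I : Finset Y, #I = affDim W ∧
      ∀ j, ∃ (a : ℝ) (L : I → ℝ), ∀ x, W x j = a + ∑ i, L i * W x i := by
  have hone : ∑ y, W.col y = 1 := by
    funext x
    simpa using hsum x
  obtain ⟨I, hcard, hI⟩ := exists_finset_eq_smul_add_sum (K := ℝ) W.col one_ne_zero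
    (hone ▸ Submodule.sum_mem _ fun y _ => Submodule.subset_span ⟨y, rfl⟩)
  rw [← W.rank_eq_finrank_span_cols, rank_eq_affDim_add_one hsum] at hcard
  refine ⟨I, by omega, fun j => ?_⟩
  obtain ⟨a, L, h⟩ := hI j
  exact ⟨a, L, fun x => by simpa using congrFun h x⟩

end LinearAlgebra

section Counting

variable {ι : Type*} [Fintype ι] {ρ : ℝ}

lemma card_le_of_forall_abs_sub_le {T : Finset (ι → ℕ)} {c : ι → ℝ} (hρ : 0 ≤ ρ)
    (hT : ∀ τ ∈ T, ∀ i, |(τ i : ℝ) - c i| ≤ ρ) : #T ≤ ⌊2 * ρ + 1⌋₊ ^ Fintype.card ι := by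
  classical
  have hsub : T ⊆ Fintype.piFinset fun i => Icc ⌈c i - ρ⌉₊ ⌊c i + ρ⌋₊ := fun τ hτ => by
    refine Fintype.mem_piFinset.2 fun i => ?_
    obtain ⟨hlow, hup⟩ := abs_le.1 (hT τ hτ i)
    exact mem_Icc.2 ⟨Nat.ceil_le.2 (by linarith), Nat.le_floor (by linarith)⟩
  have hIcc : ∀ i, #(Icc ⌈c i - ρ⌉₊ ⌊c i + ρ⌋₊) ≤ ⌊2 * ρ + 1⌋₊ := fun i => by
    have hfloor : (⌊c i + ρ⌋₊ : ℝ) + 1 - ⌈c i - ρ⌉₊ ≤ 2 * ρ + 1 := by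
      rcases le_total 0 (c i + ρ) with h | h
      · linarith [Nat.floor_le h, Nat.le_ceil (c i - ρ)]
      · rw [Nat.floor_of_nonpos h, Nat.cast_zero]
        linarith [Nat.cast_nonneg (α := ℝ) ⌈c i - ρ⌉₊]
    rw [Nat.card_Icc, tsub_le_iff_right]
    have h := Nat.lt_floor_add_one (2 * ρ + 1)
    exact_mod_cast Nat.lt_succ_iff.1 (by exact_mod_cast (by linarith :
      (⌊c i + ρ⌋₊ : ℝ) + 1 < ⌊2 * ρ + 1⌋₊ + ⌈c i - ρ⌉₊ + 1))
  calc #T ≤ ∏ i, #(Icc ⌈c i - ρ⌉₊ ⌊c i + ρ⌋₊) :=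
        (card_le_card hsub).trans_eq (Fintype.card_piFinset _)
    _ ≤ ⌊2 * ρ + 1⌋₊ ^ Fintype.card ι := prod_le_pow_card _ _ _ fun i _ => hIcc i

variable {T : Finset (ι → ℕ)} {n : ℕ} {I : Finset ι}

lemma eq_of_sum_eq_of_forall_ne {τ τ' : ι → ℕ} (hsum : ∑ i, τ i = ∑ i, τ' i) {i₀ : ι}
    (h : ∀ i ≠ i₀, τ i = τ' i) : τ = τ' := by
  classical
  funext i
  by_cases hi : i = i₀
  · subst hi
    rw [← add_sum_erase _ _ (mem_univ i), ← add_sum_erase univ τ' (mem_univ i),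
      sum_congr rfl fun j hj => h j (ne_of_mem_erase hj)] at hsum
    exact Nat.add_right_cancel hsum
  · exact h i hi

lemma injOn_restrict_compl_insert [DecidableEq ι] (hTsum : ∀ τ ∈ T, ∑ i, τ i = n) (i₀ : ι)
    (a : I → ℕ) :
    Set.InjOn (insert i₀ I)ᶜ.restrict ({τ ∈ T | I.restrict τ = a} : Set (ι → ℕ)) := by
  rintro τ ⟨hτ, hτa⟩ τ' ⟨hτ', hτ'a⟩ h
  refine eq_of_sum_eq_of_forall_ne (i₀ := i₀) ((hTsum τ hτ).trans (hTsum τ' hτ').symm)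
    fun i hi => ?_
  by_cases hiI : i ∈ I
  · exact congrFun (hτa.trans hτ'a.symm) ⟨i, hiI⟩
  · exact congrFun h ⟨i, by simp [hi, hiI]⟩

lemma card_le_of_forall_abs_sub_restrict_le (hTsum : ∀ τ ∈ T, ∑ i, τ i = n) {i₀ : ι}
    (hi₀ : i₀ ∉ I) (hρ : 0 ≤ ρ) (c : (I → ℕ) → ι → ℝ)
    (hT : ∀ τ ∈ T, ∀ i, |(τ i : ℝ) - c (I.restrict τ) i| ≤ ρ) :
    (#T : ℝ) ≤ (n + 1) ^ #I * (2 * ρ + 1) ^ (Fintype.card ι - 1 - #I) := by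
  classical
  have himage : #(T.image I.restrict) ≤ (n + 1) ^ #I := by
    refine (card_le_card (t := Fintype.piFinset fun _ => range (n + 1)) ?_).trans_eq (by simp)
    refine image_subset_iff.2 fun τ hτ => Fintype.mem_piFinset.2 fun i => ?_
    rw [mem_range_succ_iff, ← hTsum τ hτ]
    exact single_le_sum (fun _ _ => Nat.zero_le _) (mem_univ i.1)
  have hcard : Fintype.card ↥(insert i₀ I)ᶜ = Fintype.card ι - 1 - #I := by
    rw [Fintype.card_coe, card_compl, card_insert_of_notMem hi₀, Nat.sub_sub, Nat.add_comm]
  have hfiber : ∀ a, #{τ ∈ T | I.restrict τ = a} ≤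
      ⌊2 * ρ + 1⌋₊ ^ (Fintype.card ι - 1 - #I) := fun a => by
    rw [← hcard, ← card_image_of_injOn (by simpa using injOn_restrict_compl_insert hTsum i₀ a)]
    refine card_le_of_forall_abs_sub_le (c := fun i => c a i) hρ fun σ hσ i => ?_
    obtain ⟨τ, hτ, rfl⟩ := mem_image.1 hσ
    obtain ⟨hτT, rfl⟩ := mem_filter.1 hτ
    exact hT τ hτT i
  have hnat := (card_le_mul_card_image T _ fun a _ => hfiber a).trans
    (Nat.mul_le_mul_left _ himage)
  calc (#T : ℝ) ≤ ⌊2 * ρ + 1⌋₊ ^ (Fintype.card ι - 1 - #I) * (n + 1) ^ #I := by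
        exact_mod_cast hnat
    _ ≤ (2 * ρ + 1) ^ (Fintype.card ι - 1 - #I) * (n + 1) ^ #I := by
        gcongr
        exact Nat.floor_le (by positivity)
    _ = _ := mul_comm _ _

end Counting

section Converse

variable {X Y : Type*} [Fintype Y] {W : Matrix X Y ℝ} {n : ℕ} {R : ℝ}

open scoped Classical in
/-- The symbol counts of words of length `n` lying within `R`, in every coordinate, of the mean
output counts of some input word. -/
noncomputable def nearCounts (W : Matrix X Y ℝ) (n : ℕ) (R : ℝ) : Finset (Y → ℕ) :=
  {τ ∈ Fintype.piFinset fun _ => range (n + 1) |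
    ∑ y, τ y = n ∧ ∃ x : Fin n → X, ∀ y, |(τ y : ℝ) - ∑ t, W (x t) y| < R}

lemma mem_nearCounts {τ : Y → ℕ} :
    τ ∈ nearCounts W n R ↔
      ∑ y, τ y = n ∧ ∃ x : Fin n → X, ∀ y, |(τ y : ℝ) - ∑ t, W (x t) y| < R := by
  simp only [nearCounts, mem_filter, Fintype.mem_piFinset, mem_range_succ_iff,
    and_iff_right_iff_imp]
  rintro ⟨rfl, -⟩ y
  exact single_le_sum (fun _ _ => Nat.zero_le _) (mem_univ y)

lemma abs_sub_affine_le_of_mem_nearCounts {I : Finset Y} {a : ℝ} {L : I → ℝ} {j : Y}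
    (hL : ∀ x, W x j = a + ∑ i, L i * W x i) {τ : Y → ℕ} (hτ : τ ∈ nearCounts W n R) :
    |(τ j : ℝ) - (n * a + ∑ i, L i * I.restrict τ i)| ≤ (1 + ∑ i, |L i|) * R := by
  obtain ⟨-, x, hx⟩ := mem_nearCounts.1 hτ
  have hmean : ∑ t, W (x t) j = n * a + ∑ i, L i * ∑ t, W (x t) i := by
    simp only [hL, sum_add_distrib, sum_const, card_univ, Fintype.card_fin, nsmul_eq_mul, mul_sum]
    rw [sum_comm]
  have hsplit : (τ j : ℝ) - (n * a + ∑ i, L i * I.restrict τ i) =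
      (τ j - ∑ t, W (x t) j) - ∑ i, L i * (τ i - ∑ t, W (x t) i) := by
    simp only [hmean, mul_sub, sum_sub_distrib, restrict_def]
    ring
  calc |(τ j : ℝ) - (n * a + ∑ i, L i * I.restrict τ i)|
      ≤ |(τ j : ℝ) - ∑ t, W (x t) j| + |∑ i, L i * (τ i - ∑ t, W (x t) i)| :=
        hsplit ▸ abs_sub _ _
    _ ≤ R + ∑ i, |L i| * R := by
        gcongr
        · exact (hx j).le
        · refine (abs_sum_le_sum_abs _ _).trans (sum_le_sum fun i _ => ?_)
          rw [abs_mul]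
          gcongr
          exact (hx i).le
    _ = (1 + ∑ i, |L i|) * R := by rw [← sum_mul]; ring

lemma exists_card_nearCounts_le [Fintype X] [Nonempty X] (hsum : ∀ x, ∑ y, W x y = 1) :
    ∃ κ : ℝ, 0 < κ ∧ ∀ (n : ℕ) (R : ℝ), 0 ≤ R → (#(nearCounts W n R) : ℝ) ≤
      (n + 1) ^ affDim W * (κ * R + 1) ^ (Fintype.card Y - 1 - affDim W) := by
  obtain ⟨I, hI, haff⟩ := exists_affine_column_basis hsum
  choose a L hL using haff
  obtain ⟨y₀, hy₀⟩ := exists_mem_notMem_of_card_lt_card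
    (hI.trans_lt (affDim_lt_card hsum) : #I < #(univ : Finset Y))
  have hL0 : ∀ j, 0 ≤ ∑ i, |L j i| := fun j => sum_nonneg fun _ _ => abs_nonneg _
  have : 0 ≤ ∑ j, ∑ i, |L j i| := sum_nonneg fun j _ => hL0 j
  refine ⟨2 * (1 + ∑ j, ∑ i, |L j i|), by positivity, fun n R hR => ?_⟩
  rw [← hI, mul_assoc]
  refine card_le_of_forall_abs_sub_restrict_le (fun τ hτ => (mem_nearCounts.1 hτ).1) hy₀.2
    (by positivity) (fun σ j => n * a j + ∑ i, L j i * σ i) fun τ hτ j => ?_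
  refine (abs_sub_affine_le_of_mem_nearCounts (hL j) hτ).trans ?_
  gcongr
  exact single_le_sum (f := fun j => ∑ i, |L j i|) (fun j _ => hL0 j) (mem_univ j)

lemma exists_card_nearCounts_mul_div_sqrt_pow_le [Fintype X] [Nonempty X]
    (hsum : ∀ x, ∑ y, W x y = 1) {B c : ℝ} (hB : 0 ≤ B) (hc : 0 < c) :
    ∃ K : ℝ, ∀ n : ℕ, 0 < n →
      #(nearCounts W n (B * √n)) * (c / √n) ^ (Fintype.card Y - 1) ≤ K * √n ^ affDim W := by
  obtain ⟨κ, hκ, hcard⟩ := exists_card_nearCounts_le hsum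
  obtain ⟨e, he⟩ := Nat.exists_eq_add_of_le (Nat.le_sub_one_of_lt (affDim_lt_card hsum))
  rw [he] at hcard ⊢
  refine ⟨2 ^ affDim W * (κ * B + 1) ^ e * c ^ (affDim W + e), fun n hn => ?_⟩
  have hs : 1 ≤ √(n : ℝ) := one_le_sqrt.2 (Nat.one_le_cast.2 hn)
  have hn2 : (n : ℝ) + 1 ≤ 2 * √n ^ 2 := by
    rw [sq_sqrt (Nat.cast_nonneg n)]
    linarith [Nat.one_le_cast (α := ℝ).2 hn]
  calc #(nearCounts W n (B * √n)) * (c / √n) ^ (affDim W + e)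
      ≤ (n + 1) ^ affDim W * (κ * (B * √n) + 1) ^ e * (c / √n) ^ (affDim W + e) := by
        gcongr
        simpa using hcard n (B * √n) (by positivity)
    _ ≤ (2 * √n ^ 2) ^ affDim W * ((κ * B + 1) * √n) ^ e * (c / √n) ^ (affDim W + e) := by
        gcongr
        linarith
    _ = 2 ^ affDim W * (κ * B + 1) ^ e * c ^ (affDim W + e) * √n ^ affDim W := by
        rw [mul_pow, mul_pow, div_pow]
        field_simp
        ring

variable [DecidableEq Y]

lemma sum_dmcLaw_symbolCount_notMem_nearCounts_le (hW : ∀ x y, 0 ≤ W x y)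
    (hsum : ∀ x, ∑ y, W x y = 1) (hR : 0 < R) (x : Fin n → X) :
    ∑ z with symbolCount z ∉ nearCounts W n R, dmcLaw W x z ≤ Fintype.card Y * (n / R ^ 2) := by
  have hsingle : ∀ y y', |(Pi.single y 1 : Y → ℝ) y'| ≤ 1 := fun y y' => by
    rw [Pi.single_apply]
    split_ifs <;> simp
  have hdeviation := sum_dmcLaw_exists_le_abs_le hW hsum x (g := fun y => Pi.single y 1) hsingle hR
  simp only [sum_comp_eq_sum_symbolCount] at hdeviation
  calc ∑ z with symbolCount z ∉ nearCounts W n R, dmcLaw W x z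
      ≤ ∑ z with ∃ y, R ≤ |(symbolCount z y : ℝ) - ∑ t, W (x t) y|, dmcLaw W x z := by
        refine sum_le_sum_of_subset_of_nonneg (monotone_filter_right _ fun z _ hz => ?_)
          fun z _ _ => dmcLaw_nonneg hW _ _
        by_contra! hcon
        exact hz (mem_nearCounts.2 ⟨sum_symbolCount z, x, hcon⟩)
    _ ≤ Fintype.card Y * (n / R ^ 2) := by simpa [Pi.single_apply] using hdeviation

end Converse

section StrongConverse

variable {X Y : Type*} [Fintype Y] [DecidableEq Y] {W : Matrix X Y ℝ} {n M : ℕ}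

lemma permLaw_le_div_card_typeClass {P : ℝ} {x : Fin n → X} {y : Fin n → Y}
    (hP : ∑ z ∈ typeClass n (symbolCount y), dmcLaw W x z ≤ P) :
    permLaw W x y ≤ P / #(typeClass n (symbolCount y)) := by
  have hcard : 0 < #(typeClass n (symbolCount y)) := card_pos.2 ⟨y, mem_typeClass.2 rfl⟩
  rw [le_div_iff₀ (Nat.cast_pos.2 hcard), mul_comm]
  exact (card_typeClass_mul_permLaw x y).trans_le hP

lemma sum_div_card_typeClass_le {P : ℝ} (hP : 0 ≤ P) (G : Finset (Y → ℕ)) :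
    ∑ y : Fin n → Y with symbolCount y ∈ G, P / #(typeClass n (symbolCount y)) ≤ #G * P := by
  rw [← sum_fiberwise_of_maps_to (t := G) (g := symbolCount) fun y hy => (mem_filter.1 hy).2,
    ← nsmul_eq_mul]
  refine sum_le_card_nsmul _ _ _ fun τ hτ => ?_
  have hclass : ({y | symbolCount y ∈ G} : Finset (Fin n → Y)).filter (symbolCount · = τ) =
      typeClass n τ := by
    ext y
    simp only [mem_filter, mem_univ, true_and, mem_typeClass, and_iff_right_iff_imp]
    rintro rfl
    exact hτ
  rw [hclass, sum_congr rfl fun y hy => by rw [mem_typeClass.1 hy], sum_const, nsmul_eq_mul]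
  rw [mul_div_left_comm]
  exact mul_le_of_le_one_right hP (div_self_le_one _)

lemma sum_permLaw_symbolCount_notMem (x : Fin n → X) (G : Finset (Y → ℕ)) :
    ∑ y with symbolCount y ∉ G, permLaw W x y = ∑ z with symbolCount z ∉ G, dmcLaw W x z := by
  simpa [sum_filter] using sum_permLaw_mul_of_comp_perm (W := W) x
    (h := fun y => if symbolCount y ∉ G then 1 else 0) fun y σ => by rw [symbolCount_comp_perm]

lemma card_mul_one_sub_errProb (hsum : ∀ x, ∑ y, W x y = 1) (hM : 0 < M) (C : Code X Y n M) :
    M * (1 - errProb W C) = ∑ u, ∑ y with C.dec y = some u, permLaw W (C.enc u) y := by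
  have hsuccess : ∀ u, ∑ y with C.dec y = some u, permLaw W (C.enc u) y =
      1 - ∑ y with C.dec y ≠ some u, permLaw W (C.enc u) y := fun u => by
    rw [eq_sub_iff_add_eq, sum_filter_add_sum_filter_not, sum_permLaw hsum]
  simp only [hsuccess, sum_sub_distrib, errProb, mul_sub, ← sum_filter]
  rw [mul_div_cancel₀ _ (Nat.cast_ne_zero.2 hM.ne')]
  simp

lemma sum_sum_filter_eq_some_le {α β : Type*} [Fintype β] [DecidableEq β] (s : Finset α)
    (g : α → Option β) {f : α → ℝ} (hf : ∀ a, 0 ≤ f a) :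
    ∑ b, ∑ a ∈ s with g a = some b, f a ≤ ∑ a ∈ s, f a :=
  calc ∑ b, ∑ a ∈ s with g a = some b, f a
      = ∑ o ∈ univ.map Function.Embedding.some, ∑ a ∈ s with g a = o, f a := by
        rw [sum_map]
        rfl
    _ ≤ ∑ a ∈ s, f a :=
        sum_fiberwise_le_sum_of_sum_fiber_nonneg fun _ _ => sum_nonneg fun _ _ => hf _

lemma card_mul_one_sub_errProb_le (hW : ∀ x y, 0 ≤ W x y) (hsum : ∀ x, ∑ y, W x y = 1)
    (hM : 0 < M) (C : Code X Y n M) (G : Finset (Y → ℕ)) {δ P : ℝ}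
    (hδ : ∀ x : Fin n → X, ∑ z with symbolCount z ∉ G, dmcLaw W x z ≤ δ)
    (hP : ∀ (x : Fin n → X) τ, ∑ z ∈ typeClass n τ, dmcLaw W x z ≤ P) :
    M * (1 - errProb W C) ≤ M * δ + #G * P := by
  have hP0 : 0 ≤ P := (sum_nonneg fun _ _ => dmcLaw_nonneg hW _ _).trans (hP (C.enc ⟨0, hM⟩) 0)
  have hsplit : ∀ u, ∑ y with C.dec y = some u, permLaw W (C.enc u) y ≤
      δ + ∑ y ∈ {y | symbolCount y ∈ G} with C.dec y = some u,
        P / #(typeClass n (symbolCount y)) := fun u =>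
    calc ∑ y with C.dec y = some u, permLaw W (C.enc u) y
        = ∑ y ∈ {y | symbolCount y ∉ G} with C.dec y = some u, permLaw W (C.enc u) y +
            ∑ y ∈ {y | symbolCount y ∈ G} with C.dec y = some u, permLaw W (C.enc u) y := by
          rw [filter_comm, filter_comm (symbolCount · ∈ G), sum_filter_not_add_sum_filter]
      _ ≤ ∑ y with symbolCount y ∉ G, permLaw W (C.enc u) y +
            ∑ y ∈ {y | symbolCount y ∈ G} with C.dec y = some u,
              P / #(typeClass n (symbolCount y)) :=
          add_le_add (sum_le_sum_of_subset_of_nonneg (filter_subset _ _) fun y _ _ =>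
              permLaw_nonneg hW _ _)
            (sum_le_sum fun y _ => permLaw_le_div_card_typeClass (hP _ _))
      _ ≤ _ := by
          rw [sum_permLaw_symbolCount_notMem]
          gcongr
          exact hδ _
  have hdecode : ∑ u, ∑ y ∈ {y | symbolCount y ∈ G} with C.dec y = some u,
      P / #(typeClass n (symbolCount y)) ≤ #G * P :=
    (sum_sum_filter_eq_some_le _ C.dec fun _ => by positivity).trans
      (sum_div_card_typeClass_le hP0 G)
  calc M * (1 - errProb W C)
      = ∑ u, ∑ y with C.dec y = some u, permLaw W (C.enc u) y :=
        card_mul_one_sub_errProb hsum hM C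
    _ ≤ ∑ u, (δ + ∑ y ∈ {y | symbolCount y ∈ G} with C.dec y = some u,
          P / #(typeClass n (symbolCount y))) := sum_le_sum fun u _ => hsplit u
    _ ≤ M * δ + #G * P := by
        rw [sum_add_distrib]
        simpa using hdecode

variable [Fintype X] [Nonempty X]

lemma exists_forall_code_card_le (hpos : ∀ x y, 0 < W x y) (hsum : ∀ x, ∑ y, W x y = 1) {ε : ℝ}
    (hε : ε < 1) :
    ∃ K : ℝ, ∀ n : ℕ, 0 < n → ∀ M : ℕ, 0 < M → ∀ C : Code X Y n M, errProb W C ≤ ε →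
      (M : ℝ) ≤ K * √n ^ affDim W := by
  have hW : ∀ x y, 0 ≤ W x y := fun x y => (hpos x y).le
  have hY : 0 < Fintype.card Y := (Nat.zero_le _).trans_lt (affDim_lt_card hsum)
  have := Fintype.card_pos_iff.1 hY
  obtain ⟨q, hq⟩ := Finite.exists_min fun q : X × Y => W q.1 q.2
  have hε' : 0 < 1 - ε := sub_pos.2 hε
  set B := √(2 * Fintype.card Y / (1 - ε))
  have hB : B ^ 2 = 2 * Fintype.card Y / (1 - ε) := sq_sqrt (by positivity)
  have hB0 : 0 < B := sqrt_pos.2 (by positivity)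
  have hw := hpos q.1 q.2
  obtain ⟨K, hcard⟩ := exists_card_nearCounts_mul_div_sqrt_pow_le hsum hB0.le
    (c := √π / (2 * W q.1 q.2)) (by positivity)
  refine ⟨2 / (1 - ε) * K, fun n hn M hM C hC => ?_⟩
  have hn' : (0 : ℝ) < n := Nat.cast_pos.2 hn
  have hatypical : ∀ x : Fin n → X,
      ∑ z with symbolCount z ∉ nearCounts W n (B * √n), dmcLaw W x z ≤ (1 - ε) / 2 := fun x => by
    refine (sum_dmcLaw_symbolCount_notMem_nearCounts_le hW hsum (by positivity) x).trans_eq ?_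
    rw [mul_pow, hB, sq_sqrt hn'.le]
    field_simp
  have hsuccess := card_mul_one_sub_errProb_le hW hsum hM C _ hatypical fun x τ =>
    (sum_typeClass_dmcLaw_le hw (fun x y => hq (x, y)) hsum hn x τ).trans_eq
      (by rw [div_mul_eq_div_div])
  have herr : (M : ℝ) * (1 - ε) ≤ M * (1 - errProb W C) := by gcongr
  have hM_mul : (M : ℝ) * (1 - ε) ≤ 2 * (K * √n ^ affDim W) := by linarith [hcard n hn]
  calc (M : ℝ) ≤ 2 * (K * √n ^ affDim W) / (1 - ε) := (le_div_iff₀ hε').2 hM_mul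
    _ = 2 / (1 - ε) * K * √n ^ affDim W := by ring

end StrongConverse

section Achievability

variable {X Y : Type*} [Fintype Y] {W : Matrix X Y ℝ} {n M k : ℕ}
  {r : Fin (k + 1) → X} {B : Matrix Y (Fin (k + 1)) ℝ}

lemma exists_word_sum_mul_eq (hB : W.submatrix r id * B = 1) {a : Fin k → ℕ}
    (ha : ∑ j, a j ≤ n) :
    ∃ x : Fin n → X, ∀ j, ∑ t, ∑ y, W (x t) y * B y (Fin.succ j) = a j := by
  obtain ⟨v, hv⟩ := exists_word_symbolCount_eq (n := n) (c := Fin.cons (n - ∑ j, a j) a)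
    (by simp [Fin.sum_univ_succ, ha])
  refine ⟨r ∘ v, fun j => ?_⟩
  have hentry : ∀ i, ∑ y, W (r i) y * B y j.succ = if i = j.succ then 1 else 0 := fun i =>
    (congrFun (congrFun hB i) j.succ).trans Matrix.one_apply
  have hcount : symbolCount v j.succ = a j := by rw [hv, Fin.cons_succ]
  simp only [Function.comp_apply, hentry, sum_boole, ← hcount, symbolCount]

variable [DecidableEq Y]

open scoped Classical in
lemma exists_code_errProb_le_of_pairwise_disjoint (hW : ∀ x y, 0 ≤ W x y) (hM : 0 < M)
    (enc : Fin M → Fin n → X) {accept : Fin M → Set (Fin n → Y)}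
    (hdisj : Pairwise (Function.onFun Disjoint accept))
    (hperm : ∀ u y (σ : Equiv.Perm (Fin n)), y ∘ σ ∈ accept u ↔ y ∈ accept u) {δ : ℝ}
    (hδ : ∀ u, ∑ z with z ∉ accept u, dmcLaw W (enc u) z ≤ δ) :
    ∃ C : Code X Y n M, errProb W C ≤ δ := by
  let C : Code X Y n M :=
    { enc := enc
      dec := fun y => if h : ∃ u, y ∈ accept u then some h.choose else none }
  have hdec : ∀ u, ∀ y ∈ accept u, C.dec y = some u := fun u y hy => by
    have hex : ∃ u, y ∈ accept u := ⟨u, hy⟩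
    by_contra hne
    rw [show C.dec y = some hex.choose from dif_pos hex, Option.some_inj] at hne
    exact (hdisj hne).ne_of_mem hex.choose_spec hy rfl
  have herr : ∀ u, ∑ y with C.dec y ≠ some u, permLaw W (C.enc u) y ≤ δ := fun u =>
    calc ∑ y with C.dec y ≠ some u, permLaw W (C.enc u) y
        ≤ ∑ y with y ∉ accept u, permLaw W (C.enc u) y :=
          sum_le_sum_of_subset_of_nonneg (monotone_filter_right _ fun y _ => mt (hdec u y))
            fun y _ _ => permLaw_nonneg hW _ _
      _ = ∑ z with z ∉ accept u, dmcLaw W (enc u) z := by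
          simpa [sum_filter] using sum_permLaw_mul_of_comp_perm (W := W) (enc u)
            (h := fun y => if y ∉ accept u then 1 else 0) fun y σ => by simp only [hperm]
      _ ≤ δ := hδ u
  refine ⟨C, ?_⟩
  rw [errProb, div_le_iff₀ (Nat.cast_pos.2 hM), mul_comm]
  simpa [sum_filter] using sum_le_card_nsmul univ _ δ fun u _ => herr u

lemma eq_of_abs_sub_mul_lt_half {a b : ℕ} {D s : ℝ} (ha : |s - a * D| < D / 2)
    (hb : |s - b * D| < D / 2) : a = b := by
  have hD : 0 < D := by linarith [abs_nonneg (s - a * D)]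
  have hlt : |((a - b : ℤ) : ℝ)| * D < 1 * D := by
    rw [← abs_of_pos hD, ← abs_mul, abs_of_pos hD]
    push_cast
    calc |((a : ℝ) - b) * D| = |(s - b * D) - (s - a * D)| := by ring_nf
      _ ≤ |s - b * D| + |s - a * D| := abs_sub _ _
      _ < 1 * D := by linarith
  have hint : |(a - b : ℤ)| < 1 := by exact_mod_cast lt_of_mul_lt_mul_right hlt hD.le
  have := Int.abs_lt_one_iff.1 hint
  omega

lemma exists_code_errProb_le (hW : ∀ x y, 0 ≤ W x y) (hsum : ∀ x, ∑ y, W x y = 1)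
    (hB : W.submatrix r id * B = 1) {G : ℝ} (hG : ∀ y j, |B y j| ≤ G) {D J : ℕ} (hD : 0 < D)
    (hJ : 0 < J) (hn : k * (J * D) ≤ n) :
    ∃ C : Code X Y n (J ^ k), errProb W C ≤ k * (n * G ^ 2 / (D / 2) ^ 2) := by
  have hD' : (0 : ℝ) < D / 2 := half_pos (Nat.cast_pos.2 hD)
  have hword : ∀ u : Fin k → Fin J, ∃ x : Fin n → X,
      ∀ j, ∑ t, ∑ y, W (x t) y * B y (Fin.succ j) = (u j : ℕ) * D := fun u => by
    have hle : ∑ j, (u j : ℕ) * D ≤ n := by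
      refine le_trans ?_ hn
      simpa using sum_le_card_nsmul univ (fun j => (u j : ℕ) * D) (J * D) fun j _ =>
        Nat.mul_le_mul_right D (u j).2.le
    simpa using exists_word_sum_mul_eq hB hle
  choose enc henc using hword
  let accept (u : Fin k → Fin J) : Set (Fin n → Y) :=
    {y | ∀ j, |∑ t, B (y t) (Fin.succ j) - (u j : ℕ) * D| < D / 2}
  let msg : Fin (J ^ k) ≃ (Fin k → Fin J) := finFunctionFinEquiv.symm
  refine exists_code_errProb_le_of_pairwise_disjoint hW (pow_pos hJ k) (enc ∘ msg)
    (accept := accept ∘ msg) (fun u v huv => ?_) (fun u y σ => ?_) fun u => ?_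
  · refine Set.disjoint_left.2 fun y hyu hyv => huv (msg.injective (funext fun j => ?_))
    exact Fin.ext (eq_of_abs_sub_mul_lt_half (hyu j) (hyv j))
  · refine forall_congr' fun j => ?_
    simp only [Function.comp_apply, Equiv.sum_comp σ fun t => B (y t) (Fin.succ j)]
  · have hdeviation := sum_dmcLaw_exists_le_abs_le hW hsum (enc (msg u))
      (g := fun (j : Fin k) y => B y j.succ) (fun j y => hG y j.succ) hD'
    simpa [accept, henc] using hdeviation

lemma exists_eventually_grid {β : ℝ} (hβ : 0 < β) (k : ℕ) :
    ∃ c : ℝ, 0 < c ∧ ∀ᶠ n : ℕ in Filter.atTop, ∃ D J : ℕ,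
      0 < J ∧ β * √n ≤ D ∧ k * (J * D) ≤ n ∧ c * √n ≤ J := by
  set q : ℝ := (k + 1) * (β + 1)
  have hq : 1 ≤ q := one_le_mul_of_one_le_of_one_le (by simp) (by linarith)
  have hq0 : 0 < q := one_pos.trans_le hq
  have hlarge : ∀ᶠ n : ℕ in Filter.atTop, 2 * q ≤ √(n : ℝ) :=
    (tendsto_sqrt_atTop.comp tendsto_natCast_atTop_atTop).eventually_ge_atTop _
  refine ⟨1 / (2 * q), by positivity, ?_⟩
  filter_upwards [hlarge] with n hn
  have hD : (⌈β * √n⌉₊ : ℝ) ≤ (β + 1) * √n := by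
    linarith [Nat.ceil_lt_add_one (a := β * √n) (by positivity)]
  have hJ : 1 / (2 * q) * √n ≤ (⌊√n / q⌋₊ : ℝ) := by
    have hfloor := Nat.lt_floor_add_one (√n / q)
    have htwo : 2 ≤ √n / q := (le_div_iff₀ hq0).2 hn
    have hhalf : 1 / (2 * q) * √n = √n / q / 2 := by field_simp
    linarith
  refine ⟨⌈β * √n⌉₊, ⌊√n / q⌋₊, ?_, Nat.le_ceil _, ?_, hJ⟩
  · have hsqrt : 0 < √(n : ℝ) := by linarith
    exact Nat.cast_pos.1 ((by positivity : (0 : ℝ) < 1 / (2 * q) * √n).trans_le hJ)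
  · have hfit : (k : ℝ) * (⌊√n / q⌋₊ * ⌈β * √n⌉₊) ≤ n :=
      calc (k : ℝ) * (⌊√n / q⌋₊ * ⌈β * √n⌉₊) ≤ (k + 1) * (√n / q * ((β + 1) * √n)) := by
            gcongr
            · linarith
            · exact Nat.floor_le (by positivity)
        _ = √n ^ 2 := by
            simp only [q]
            field_simp
        _ = n := sq_sqrt (Nat.cast_nonneg n)
    exact_mod_cast hfit

lemma exists_eventually_code_card_ge [Fintype X] [Nonempty X] (hW : ∀ x y, 0 ≤ W x y)
    (hsum : ∀ x, ∑ y, W x y = 1) {ε : ℝ} (hε : 0 < ε) :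
    ∃ c : ℝ, 0 < c ∧ ∀ᶠ n : ℕ in Filter.atTop, ∃ M : ℕ, 0 < M ∧ c * √n ^ affDim W ≤ M ∧
      ∃ C : Code X Y n M, errProb W C ≤ ε := by
  obtain ⟨r, B, hB⟩ := exists_submatrix_mul_eq_one (rank_eq_affDim_add_one hsum)
  obtain ⟨G, hG⟩ := (Set.finite_range fun q : Y × Fin (affDim W + 1) => |B q.1 q.2|).bddAbove
  set β := 4 * affDim W * G ^ 2 / ε + 1
  have hβ1 : 1 ≤ β := by simp only [β, le_add_iff_nonneg_left]; positivity
  obtain ⟨c, hc, hgrid⟩ := exists_eventually_grid (one_pos.trans_le hβ1) (affDim W)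
  refine ⟨c ^ affDim W, by positivity, ?_⟩
  filter_upwards [hgrid, Filter.eventually_gt_atTop 0] with n ⟨D, J, hJ, hD, hfit, hcJ⟩ hn
  have hn' : (0 : ℝ) < n := Nat.cast_pos.2 hn
  have hD0 : (0 : ℝ) < D := lt_of_lt_of_le (by positivity) hD
  obtain ⟨C, hC⟩ := exists_code_errProb_le hW hsum hB (fun y j => hG ⟨(y, j), rfl⟩)
    (Nat.cast_pos.1 hD0) hJ hfit
  refine ⟨J ^ affDim W, pow_pos hJ _, ?_, C, hC.trans ?_⟩
  · rw [← mul_pow, Nat.cast_pow]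
    gcongr
  · have hspacing : 4 * affDim W * G ^ 2 / ε * n ≤ (D : ℝ) ^ 2 :=
      calc 4 * affDim W * G ^ 2 / ε * n ≤ β ^ 2 * n := by
            gcongr
            exact (lt_add_one _).le.trans (le_self_pow₀ hβ1 two_ne_zero)
        _ = (β * √n) ^ 2 := by rw [mul_pow, sq_sqrt hn'.le]
        _ ≤ (D : ℝ) ^ 2 := by gcongr
    calc (affDim W : ℝ) * (n * G ^ 2 / (D / 2) ^ 2)
        = ε * (4 * affDim W * G ^ 2 / ε * n) / D ^ 2 := by
          field_simp
          norm_num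
      _ ≤ ε * D ^ 2 / D ^ 2 := by gcongr
      _ = ε := by field_simp

end Achievability

section Asymptotics

open Filter Asymptotics Topology

variable {α : Type*} {l : Filter α} {f g : α → ℝ}

lemma isBigO_log_sub_log_of_isTheta (h : f =Θ[l] g) (hg : ∀ᶠ a in l, g a ≠ 0) :
    (fun a => log (f a) - log (g a)) =O[l] fun _ => (1 : ℝ) := by
  obtain ⟨c₁, hc₁, hfg⟩ := h.1.exists_pos
  obtain ⟨c₂, hc₂, hgf⟩ := h.2.exists_pos
  refine IsBigO.of_bound (max (log c₁) (log c₂)) ?_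
  filter_upwards [hfg.bound, hgf.bound, hg] with a hfa hga hg0
  have hg_pos : 0 < |g a| := abs_pos.2 hg0
  have hf_pos : 0 < |f a| := pos_of_mul_pos_right (hg_pos.trans_le hga) hc₂.le
  have hupper : log (f a) ≤ log c₁ + log (g a) := by
    rw [← log_abs (f a), ← log_abs (g a), ← log_mul hc₁.ne' hg_pos.ne']
    exact log_le_log hf_pos hfa
  have hlower : log (g a) ≤ log c₂ + log (f a) := by
    rw [← log_abs (f a), ← log_abs (g a), ← log_mul hc₂.ne' hf_pos.ne']
    exact log_le_log hg_pos hga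
  rw [norm_one, mul_one, norm_eq_abs, abs_le]
  constructor <;> linarith [le_max_left (log c₁) (log c₂), le_max_right (log c₁) (log c₂)]

variable {X Y : Type*} [Fintype X] [Nonempty X] [Fintype Y] [DecidableEq Y] {W : Matrix X Y ℝ}
  {ε : ℝ}

lemma isTheta_maxMessages (hpos : ∀ x y, 0 < W x y) (hsum : ∀ x, ∑ y, W x y = 1) (hε0 : 0 < ε)
    (hε1 : ε < 1) : (fun n => (maxMessages W n ε : ℝ)) =Θ[atTop] fun n => √n ^ affDim W := by
  obtain ⟨K, hK⟩ := exists_forall_code_card_le hpos hsum hε1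
  obtain ⟨c, hc, hach⟩ := exists_eventually_code_card_ge (fun x y => (hpos x y).le) hsum hε0
  have hbounds : ∀ᶠ n : ℕ in atTop, c * √n ^ affDim W ≤ maxMessages W n ε ∧
      (maxMessages W n ε : ℝ) ≤ K * √n ^ affDim W := by
    filter_upwards [hach, eventually_gt_atTop 0] with n ⟨M, hM0, hcM, hM⟩ hn
    have hbdd : BddAbove {N : ℕ | 0 < N ∧ ∃ C : Code X Y n N, errProb W C ≤ ε} :=
      ⟨⌊K * √n ^ affDim W⌋₊, fun N ⟨hN0, C, hC⟩ => Nat.le_floor (hK n hn N hN0 C hC)⟩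
    have hmem : maxMessages W n ε ∈ {N : ℕ | 0 < N ∧ ∃ C : Code X Y n N, errProb W C ≤ ε} :=
      Nat.sSup_mem ⟨M, hM0, hM⟩ hbdd
    obtain ⟨hmax0, C, hC⟩ := hmem
    exact ⟨hcM.trans (Nat.cast_le.2 (le_csSup hbdd ⟨hM0, hM⟩)), hK n hn _ hmax0 C hC⟩
  constructor
  · refine IsBigO.of_bound K (hbounds.mono fun n hn => ?_)
    simpa [abs_of_nonneg (sqrt_nonneg (n : ℝ))] using hn.2
  · refine IsBigO.of_bound c⁻¹ (hbounds.mono fun n hn => ?_)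
    simpa [abs_of_nonneg (sqrt_nonneg (n : ℝ))] using (le_inv_mul_iff₀ hc).2 hn.1

lemma isBigO_logb_maxMessages_sub (hpos : ∀ x y, 0 < W x y) (hsum : ∀ x, ∑ y, W x y = 1)
    (hε0 : 0 < ε) (hε1 : ε < 1) :
    (fun n : ℕ => logb 2 (maxMessages W n ε) - affDim W * logb 2 √n) =O[atTop]
      fun _ => (1 : ℝ) := by
  have hne : ∀ᶠ n : ℕ in atTop, √(n : ℝ) ^ affDim W ≠ 0 := by
    filter_upwards [eventually_gt_atTop 0] with n hn
    positivity
  have hlog := isBigO_log_sub_log_of_isTheta (isTheta_maxMessages hpos hsum hε0 hε1) hne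
  refine (hlog.const_mul_left (log 2)⁻¹).congr_left fun n => ?_
  rw [log_pow, logb, logb]
  ring

lemma tendsto_logb_maxMessages_div_logb (hpos : ∀ x y, 0 < W x y)
    (hsum : ∀ x, ∑ y, W x y = 1) (hε0 : 0 < ε) (hε1 : ε < 1) :
    Tendsto (fun n : ℕ => logb 2 (maxMessages W n ε) / logb 2 n) atTop
      (𝓝 ((affDim W : ℝ) / 2)) := by
  have hlogb : Tendsto (fun n : ℕ => logb 2 (n : ℝ)) atTop atTop :=
    (tendsto_logb_atTop one_lt_two).comp tendsto_natCast_atTop_atTop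
  have hone : (fun _ : ℕ => (1 : ℝ)) =o[atTop] fun n => logb 2 (n : ℝ) :=
    (isLittleO_const_left_of_ne one_ne_zero).2 (tendsto_norm_atTop_atTop.comp hlogb)
  have hzero :=
    ((isBigO_logb_maxMessages_sub hpos hsum hε0 hε1).trans_isLittleO hone).tendsto_div_nhds_zero
  refine (zero_add ((affDim W : ℝ) / 2) ▸ hzero.add_const _).congr' ?_
  filter_upwards [hlogb.eventually_ne_atTop 0] with n hn
  have hhalf : logb 2 √(n : ℝ) = logb 2 n / 2 := by
    rw [logb, log_sqrt n.cast_nonneg, div_right_comm, logb]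
  rw [hhalf]
  field_simp
  ring

lemma epsCapacity_eq (hpos : ∀ x y, 0 < W x y) (hsum : ∀ x, ∑ y, W x y = 1) (hε0 : 0 < ε)
    (hε1 : ε < 1) : epsCapacity W ε = ((affDim W / 2 : ℝ) : EReal) :=
  ((continuous_coe_real_ereal.tendsto _).comp
    (tendsto_logb_maxMessages_div_logb hpos hsum hε0 hε1)).liminf_eq

end Asymptotics

end NoisyPerm

theorem mainTheorem1_general {X Y : Type*} [Fintype X] [Nonempty X] [Fintype Y] [DecidableEq Y]
    (W : Matrix X Y ℝ) (hpos : ∀ x y, 0 < W x y) (hsum : ∀ x, ∑ y, W x y = 1) (ε : ℝ)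
    (hε0 : 0 < ε) (hε1 : ε < 1) :
    (∀ S : Affine.Simplex ℝ (EuclideanSpace ℝ Y) (NoisyPerm.affDim W),
      NoisyPerm.IsReference W S →
      0 < NoisyPerm.gaussianCoeff S ε → NoisyPerm.gaussianCoeff S ε < ⊤ →
      ∃ C : ℝ, ∀ᶠ n : ℕ in Filter.atTop,
        Real.logb 2 (NoisyPerm.maxMessages W n ε) ≤
          (NoisyPerm.affDim W : ℝ) *
              Real.logb 2 ((NoisyPerm.gaussianCoeff S ε).toReal * Real.sqrt n) +
            Real.logb 2 (NoisyPerm.volRatio W) + C) ∧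
    NoisyPerm.epsCapacity W ε = (((NoisyPerm.affDim W : ℝ) / 2 : ℝ) : EReal) ∧
    W.rank = NoisyPerm.affDim W + 1 := by
  refine ⟨fun S _ hc0 hctop => ?_, NoisyPerm.epsCapacity_eq hpos hsum hε0 hε1,
    NoisyPerm.rank_eq_affDim_add_one hsum⟩
  obtain ⟨b, hb⟩ := (NoisyPerm.isBigO_logb_maxMessages_sub hpos hsum hε0 hε1).bound
  have hc : 0 < (NoisyPerm.gaussianCoeff S ε).toReal := ENNReal.toReal_pos hc0.ne' hctop.ne
  refine ⟨b - NoisyPerm.affDim W * Real.logb 2 (NoisyPerm.gaussianCoeff S ε).toReal -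
    Real.logb 2 (NoisyPerm.volRatio W), ?_⟩
  filter_upwards [hb, Filter.eventually_gt_atTop 0] with n hn hn0
  have hsqrt : 0 < √(n : ℝ) := Real.sqrt_pos.2 (Nat.cast_pos.2 hn0)
  rw [norm_one, mul_one] at hn
  rw [Real.logb_mul hc.ne' hsqrt.ne']
  linarith [(le_abs_self _).trans hn]

theorem mainTheorem1 {X Y : Type*} [Fintype X] [Nonempty X] [Fintype Y] [DecidableEq Y]
    (W : Matrix X Y ℝ) (hpos : ∀ x y, 0 < W x y) (hsum : ∀ x, ∑ y, W x y = 1)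
    (hd : 1 ≤ NoisyPerm.affDim W) (ε : ℝ) (hε0 : 0 < ε) (hε1 : ε < 1) :
    (∀ S : Affine.Simplex ℝ (EuclideanSpace ℝ Y) (NoisyPerm.affDim W),
      NoisyPerm.IsMinReference W S →
      0 < NoisyPerm.gaussianCoeff S ε → NoisyPerm.gaussianCoeff S ε < ⊤ →
      ∃ C : ℝ, ∀ᶠ n : ℕ in Filter.atTop,
        Real.logb 2 (NoisyPerm.maxMessages W n ε) ≤
          (NoisyPerm.affDim W : ℝ) *
              Real.logb 2 ((NoisyPerm.gaussianCoeff S ε).toReal * Real.sqrt n) +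
            Real.logb 2 (NoisyPerm.volRatio W) + C) ∧
    NoisyPerm.epsCapacity W ε = (((NoisyPerm.affDim W : ℝ) / 2 : ℝ) : EReal) ∧
    W.rank = NoisyPerm.affDim W + 1 := by
  have h := mainTheorem1_general W hpos hsum ε hε0 hε1
  exact ⟨fun S hS => h.1 S hS.1, h.2⟩
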